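/- Let $k$, $n$ and $t$ be integers with $n\ge 1$ and $0\le t\le k-1$, and let $a_1,\dots,a_k$ be non-negative integers with $a_1+\cdots+a_k=n$. A $k_t$-Dyck path of length $(k+1)n$ is a lattice path consisting of $n$ steps $(1,-k)$ (down-steps) and $kn$ steps $(1,1)$ (up-steps) that starts at $(0,0)$, ends at $((k+1)n,0)$, and stays weakly above the line $y=-t$. Let $\mathcal{K}_{k,t}^{n}(a_1,\dots,a_k)$ be the set of those $k_t$-Dyck paths of length $(k+1)n$ in which, for every $1\le i\le k$, exactly $a_i$ down-steps have an endpoint (the point reached after the down-step) whose height is congruent to $i$ modulo $k$. Then $$\bigl|\mathcal{K}_{k,t}^{n}(a_1,\dots,a_k)\bigr| \;=\; \frac{a_{k-t}+\cdots+a_k}{n(n+1)}\,\prod_{i=k-t}^{k}\binom{n+a_i}{a_i}\,\prod_{i=1}^{k-t-1}\binom{n+a_i-1}{a_i}.$$ -/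

import Mathlib

namespace KtDyck

/-- The two kinds of steps: `up` is `(1, 1)` and `down` is `(1, -k)`. -/
inductive Step : Type
  | up
  | down
  deriving DecidableEq

instance : Fintype Step where
  elems := {Step.up, Step.down}
  complete := fun s => by cases s <;> decide

/-- The change of height caused by a step. -/
def Step.rise (k : ℕ) : Step → ℤ
  | Step.up => 1
  | Step.down => -(k : ℤ)

/-- The height (`y`-coordinate) of the endpoint of the lattice path that starts at `(0, 0)` and
follows the given steps. Its `x`-coordinate is the number of steps. -/
def height (k : ℕ) (p : List Step) : ℤ := (p.map (Step.rise k)).sum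

/-- `p` is the step sequence of a `k_t`-Dyck path of length `(k + 1) n`: it consists of `n` steps
`(1, -k)` and `k n` steps `(1, 1)`, starts at `(0, 0)`, ends at `((k + 1) n, 0)`, and stays weakly
above the line `y = -t`. -/
structure IsKtDyckPath (k t n : ℕ) (p : List Step) : Prop where
  length_eq : p.length = (k + 1) * n
  count_down : p.count Step.down = n
  count_up : p.count Step.up = k * n
  height_end : height k p = 0
  above : ∀ q : List Step, q <+: p → -(t : ℤ) ≤ height k q

/-- The number of down-steps of `p` whose endpoint has height congruent to `i` modulo `k`. -/
def numDown (k i : ℕ) (p : List Step) : ℕ :=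
  ((Finset.range p.length).filter fun j =>
    p[j]? = some Step.down ∧ height k (p.take (j + 1)) ≡ (i : ℤ) [ZMOD (k : ℤ)]).card

/-- The set of `k_t`-Dyck paths of length `(k + 1) n` that have, for each `1 ≤ i ≤ k`, exactly
`a i` down-steps ending at a height congruent to `i` modulo `k`. Only `a 1, …, a k` matter. -/
def paths (k t n : ℕ) (a : ℕ → ℕ) : Set (List Step) :=
  {p | IsKtDyckPath k t n p ∧ ∀ i ∈ Finset.Icc 1 k, numDown k i p = a i}

/-- There are only finitely many such paths, so that counting them by `Set.ncard` is meaningful. -/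
theorem paths_finite (k t n : ℕ) (a : ℕ → ℕ) : (paths k t n a).Finite :=
  (List.finite_length_eq Step ((k + 1) * n)).subset fun _ hp => hp.1.length_eq

end KtDyck

namespace KtDyck

/-! Modulo `k` a height equals the number of up-steps so far, so down-steps after `u` up-steps all
belong to the class of `u`. Relax the endpoint: count paths with `u` up-steps by their class
numbers. Deleting the last step gives a Pascal-type recurrence (`ncard_prefixPaths_succ`). Write `u
+ t + 1 = k * m + r`. Among `-t, …, u` each class occurs `m` times, and the first `r` classes from
`-t` on once more. `ballotCount` is the product of the resulting multiset counts times a linear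
ballot factor. It satisfies the same recurrence (`ballotCount_insert`), is consistent when `r = k`
becomes `r = 0` (`ballotCount_full`), and vanishes where the line is violated. The theorem is the
case `u = k * n`, `m = n`, `r = t + 1`. -/

/-! ### Heights and residue counts under appending a step. -/

theorem height_append_singleton (k : ℕ) (p : List Step) (s : Step) :
    height k (p ++ [s]) = height k p + s.rise k := by
  simp [height]

theorem height_eq_count (k : ℕ) (p : List Step) :
    height k p = p.count Step.up - (k : ℤ) * p.count Step.down := by
  induction p using List.reverseRecOn with
  | nil => simp [height]
  | append_singleton p s ih =>
    rw [height_append_singleton, ih]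
    cases s <;> simp [Step.rise, List.count_append] <;> ring

theorem numDown_append_singleton (k i : ℕ) (p : List Step) (s : Step) :
    numDown k i (p ++ [s]) = numDown k i p +
      if s = Step.down ∧ height k (p ++ [s]) ≡ (i : ℤ) [ZMOD (k : ℤ)] then 1 else 0 := by
  unfold numDown
  rw [List.length_append, List.length_singleton, Finset.range_add_one, Finset.filter_insert]
  have hfilter : ((Finset.range p.length).filter fun j =>
      (p ++ [s])[j]? = some Step.down ∧
        height k ((p ++ [s]).take (j + 1)) ≡ (i : ℤ) [ZMOD (k : ℤ)]) =
      (Finset.range p.length).filter fun j =>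
        p[j]? = some Step.down ∧ height k (p.take (j + 1)) ≡ (i : ℤ) [ZMOD (k : ℤ)] := by
    refine Finset.filter_congr fun j hj => ?_
    have hj' : j < p.length := Finset.mem_range.1 hj
    rw [List.getElem?_append_left hj', List.take_append_of_le_length hj']
  have htake : (p ++ [s]).take (p.length + 1) = p ++ [s] :=
    List.take_of_length_le (by simp)
  rw [hfilter, htake]
  have hlast : (p ++ [s])[p.length]? = some s := by simp
  rw [hlast]
  simp only [Option.some.injEq]
  split_ifs with h
  · rw [Finset.card_insert_of_notMem (by simp)]
  · rfl

theorem numDown_append_up (k i : ℕ) (p : List Step) :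
    numDown k i (p ++ [Step.up]) = numDown k i p := by
  rw [numDown_append_singleton]; simp

/-- Two representatives in `1, …, k` of the same residue class modulo `k` agree. -/
theorem eq_of_modEq_of_mem_Icc {k i j : ℕ} (hi : i ∈ Finset.Icc 1 k) (hj : j ∈ Finset.Icc 1 k)
    (h : (i : ℤ) ≡ (j : ℤ) [ZMOD (k : ℤ)]) : i = j := by
  rw [Finset.mem_Icc] at hi hj
  obtain ⟨c, hc⟩ := h.dvd
  have h1 : c < 1 := by
    by_contra hcon
    nlinarith [mul_le_mul_of_nonneg_left (not_lt.1 hcon) (Int.natCast_nonneg k)]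
  have h2 : -1 < c := by
    by_contra hcon
    nlinarith [mul_le_mul_of_nonneg_left (not_lt.1 hcon) (Int.natCast_nonneg k)]
  have h3 : c = 0 := by omega
  subst h3
  omega

theorem exists_modEq_mem_Icc {k : ℕ} (hk : 0 < k) (z : ℤ) :
    ∃ i ∈ Finset.Icc 1 k, z ≡ (i : ℤ) [ZMOD (k : ℤ)] := by
  have hk' : (0 : ℤ) < k := by exact_mod_cast hk
  have h0 := Int.emod_nonneg (z - 1) hk'.ne'
  have h1 := Int.emod_lt_of_pos (z - 1) hk'
  refine ⟨((z - 1) % k).toNat + 1, by rw [Finset.mem_Icc]; omega, ?_⟩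
  push_cast
  rw [Int.toNat_of_nonneg h0]
  have := ((Int.mod_modEq (z - 1) k).add_right 1).symm
  simpa using this

theorem numDown_append_down {k i r : ℕ} {p : List Step} (hi : i ∈ Finset.Icc 1 k)
    (hr : r ∈ Finset.Icc 1 k) (h : height k (p ++ [Step.down]) ≡ (r : ℤ) [ZMOD (k : ℤ)]) :
    numDown k i (p ++ [Step.down]) = numDown k i p + if i = r then 1 else 0 := by
  rw [numDown_append_singleton]
  congr 1
  refine if_congr ⟨fun h' => ?_, fun h' => ⟨rfl, h' ▸ h⟩⟩ rfl rfl
  exact eq_of_modEq_of_mem_Icc hi hr (h'.2.symm.trans h)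

theorem sum_numDown {k : ℕ} (hk : 0 < k) (p : List Step) :
    ∑ i ∈ Finset.Icc 1 k, numDown k i p = p.count Step.down := by
  induction p using List.reverseRecOn with
  | nil => simp [numDown]
  | append_singleton p s ih =>
    cases s with
    | up => simp [numDown_append_up, ih, List.count_append]
    | down =>
      obtain ⟨r, hr, h⟩ := exists_modEq_mem_Icc hk (height k (p ++ [Step.down]))
      rw [Finset.sum_congr rfl fun i hi => numDown_append_down hi hr h, Finset.sum_add_distrib, ih]
      simp [hr, List.count_append]

/-! ### Paths with a free endpoint and their recurrence. -/

/-- The paths with `u` up-steps that stay weakly above `y = -t` and have, for each `1 ≤ i ≤ k`,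
exactly `a i` down-steps ending at a height congruent to `i` modulo `k`. -/
def prefixPaths (k t u : ℕ) (a : ℕ → ℕ) : Set (List Step) :=
  {p | p.count Step.up = u ∧ (∀ q : List Step, q <+: p → -(t : ℤ) ≤ height k q) ∧
    ∀ i ∈ Finset.Icc 1 k, numDown k i p = a i}

section PrefixPaths

variable {k t u : ℕ} {a : ℕ → ℕ} {p : List Step}

theorem count_down_of_mem_prefixPaths (hk : 0 < k) (hp : p ∈ prefixPaths k t u a) :
    p.count Step.down = ∑ i ∈ Finset.Icc 1 k, a i := by
  rw [← sum_numDown hk, Finset.sum_congr rfl hp.2.2]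

theorem height_of_mem_prefixPaths (hk : 0 < k) (hp : p ∈ prefixPaths k t u a) :
    height k p = u - (k : ℤ) * (∑ i ∈ Finset.Icc 1 k, a i : ℕ) := by
  rw [height_eq_count, count_down_of_mem_prefixPaths hk hp, hp.1]

theorem length_eq_count_add_count (p : List Step) :
    p.length = p.count Step.up + p.count Step.down := by
  induction p with
  | nil => rfl
  | cons s p ih => cases s <;> simp [ih] <;> omega

theorem prefixPaths_finite (hk : 0 < k) : (prefixPaths k t u a).Finite :=
  (List.finite_length_eq Step (u + ∑ i ∈ Finset.Icc 1 k, a i)).subset fun p hp => by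
    rw [Set.mem_ofPred_eq, length_eq_count_add_count, hp.1, count_down_of_mem_prefixPaths hk hp]

theorem prefixPaths_eq_empty (hk : 0 < k)
    (h : u + t < k * ∑ i ∈ Finset.Icc 1 k, a i) : prefixPaths k t u a = ∅ := by
  refine Set.eq_empty_iff_forall_notMem.2 fun p hp => ?_
  have h1 := hp.2.1 p (List.prefix_refl p)
  rw [height_of_mem_prefixPaths hk hp] at h1
  have h2 : ((u + t : ℕ) : ℤ) < (k * ∑ i ∈ Finset.Icc 1 k, a i : ℕ) := by exact_mod_cast h
  push_cast at h1 h2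
  linarith

theorem paths_eq_prefixPaths {n : ℕ} (hk : 0 < k) (ha : ∑ i ∈ Finset.Icc 1 k, a i = n) :
    paths k t n a = prefixPaths k t (k * n) a := by
  ext p
  refine ⟨fun hp => ⟨hp.1.count_up, hp.1.above, hp.2⟩, fun hp => ⟨?_, hp.2.2⟩⟩
  have hd := count_down_of_mem_prefixPaths hk hp
  rw [ha] at hd
  refine ⟨?_, hd, hp.1, ?_, hp.2.1⟩
  · rw [length_eq_count_add_count, hp.1, hd]; ring
  · rw [height_eq_count, hp.1, hd]; push_cast; ring

theorem prefixPaths_zero (hk : 0 < k) (ha : ∑ i ∈ Finset.Icc 1 k, a i = 0) :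
    prefixPaths k t u a = {List.replicate u Step.up} := by
  have hrep : ∀ v : ℕ, ∀ i, numDown k i (List.replicate v Step.up) = 0 := by
    intro v i
    induction v with
    | zero => simp [numDown]
    | succ v ih => rw [List.replicate_succ', numDown_append_up, ih]
  ext p
  rw [Set.mem_singleton_iff]
  constructor
  · intro hp
    have hd := count_down_of_mem_prefixPaths hk hp
    rw [ha, List.count_eq_zero] at hd
    have hlen := length_eq_count_add_count p
    rw [hp.1, List.count_eq_zero.2 hd, add_zero] at hlen
    refine List.eq_replicate_iff.2 ⟨hlen, fun s hs => ?_⟩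
    cases s with
    | up => rfl
    | down => exact absurd hs hd
  · rintro rfl
    refine ⟨by simp, fun q hq => ?_, fun i hi => ?_⟩
    · obtain ⟨v, rfl⟩ : ∃ v, q = List.replicate v Step.up :=
        ⟨_, (List.prefix_replicate_iff.1 hq).2⟩
      rw [height_eq_count]
      have : (List.replicate v Step.up).count Step.down = 0 := by
        simp [List.count_replicate]
      rw [this]
      have := Int.natCast_nonneg ((List.replicate v Step.up).count Step.up)
      push_cast
      omega
    · rw [hrep, Finset.sum_eq_zero_iff.1 ha i hi]

theorem forall_prefix_append_singleton (s : Step) :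
    (∀ q : List Step, q <+: p ++ [s] → -(t : ℤ) ≤ height k q) ↔
      (∀ q : List Step, q <+: p → -(t : ℤ) ≤ height k q) ∧ -(t : ℤ) ≤ height k (p ++ [s]) := by
  constructor
  · exact fun h => ⟨fun q hq => h q (hq.trans (List.prefix_append _ _)), h _ (List.prefix_refl _)⟩
  · rintro ⟨h1, h2⟩ q hq
    rcases List.prefix_concat_iff.1 hq with rfl | hq
    · exact h2
    · exact h1 q hq

theorem append_up_mem_prefixPaths (hk : 0 < k)
    (hu : k * ∑ i ∈ Finset.Icc 1 k, a i ≤ u + 1 + t) :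
    p ++ [Step.up] ∈ prefixPaths k t (u + 1) a ↔ p ∈ prefixPaths k t u a := by
  have hu' : ((k * ∑ i ∈ Finset.Icc 1 k, a i : ℕ) : ℤ) ≤ (u + 1 + t : ℕ) := by exact_mod_cast hu
  push_cast at hu'
  constructor
  · rintro ⟨h1, h2, h3⟩
    refine ⟨by simpa [List.count_append] using h1,
      ((forall_prefix_append_singleton _).1 h2).1, fun i hi => ?_⟩
    rw [← h3 i hi, numDown_append_up]
  · intro hp
    refine ⟨by simp [List.count_append, hp.1],
      (forall_prefix_append_singleton _).2 ⟨hp.2.1, ?_⟩, fun i hi => ?_⟩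
    · rw [height_append_singleton, height_of_mem_prefixPaths hk hp, Step.rise]
      push_cast
      linarith
    · rw [numDown_append_up, hp.2.2 i hi]

/-- The class of the final down-step is forced by `u`, so only `a r` changes; `hu` says that the
endpoint respects the line. -/
theorem append_down_mem_prefixPaths {r : ℕ} (hk : 0 < k) (hr : r ∈ Finset.Icc 1 k)
    (hur : (u : ℤ) ≡ (r : ℤ) [ZMOD (k : ℤ)])
    (hu : k * ∑ i ∈ Finset.Icc 1 k, a i ≤ u + t) :
    p ++ [Step.down] ∈ prefixPaths k t u a ↔
      0 < a r ∧ p ∈ prefixPaths k t u (Function.update a r (a r - 1)) := by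
  have hu' : ((k * ∑ i ∈ Finset.Icc 1 k, a i : ℕ) : ℤ) ≤ (u + t : ℕ) := by exact_mod_cast hu
  push_cast at hu'
  have hres : p.count Step.up = u →
      height k (p ++ [Step.down]) ≡ (r : ℤ) [ZMOD (k : ℤ)] := by
    intro hc
    refine Int.ModEq.trans ?_ hur
    rw [height_eq_count]
    refine (Int.modEq_iff_dvd.2 ⟨((p ++ [Step.down]).count Step.down : ℤ), ?_⟩)
    simp [List.count_append, hc]
  constructor
  · rintro ⟨h1, h2, h3⟩
    have hc : p.count Step.up = u := by simpa [List.count_append] using h1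
    have h4 := fun i hi => (numDown_append_down hi hr (hres hc)).symm.trans (h3 i hi)
    have h5 := h4 r hr
    rw [if_pos rfl] at h5
    refine ⟨by omega, hc, ((forall_prefix_append_singleton _).1 h2).1, fun i hi => ?_⟩
    rcases eq_or_ne i r with rfl | hir
    · rw [Function.update_self]; omega
    · rw [Function.update_of_ne hir, ← h4 i hi, if_neg hir, add_zero]
  · rintro ⟨hpos, hp⟩
    have hnum : ∀ i ∈ Finset.Icc 1 k, numDown k i (p ++ [Step.down]) = a i := by
      intro i hi
      rw [numDown_append_down hi hr (hres hp.1), hp.2.2 i hi]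
      rcases eq_or_ne i r with rfl | hir
      · rw [Function.update_self, if_pos rfl]; omega
      · rw [Function.update_of_ne hir, if_neg hir, add_zero]
    have hc : (p ++ [Step.down]).count Step.up = u := by simp [List.count_append, hp.1]
    refine ⟨hc, (forall_prefix_append_singleton _).2 ⟨hp.2.1, ?_⟩, hnum⟩
    rw [height_eq_count, hc, ← sum_numDown hk, Finset.sum_congr rfl hnum]
    push_cast
    linarith

/-- Removing the last step of a path. -/
theorem ncard_prefixPaths_succ {r : ℕ} (hk : 0 < k) (hr : r ∈ Finset.Icc 1 k)
    (hur : ((u + 1 : ℕ) : ℤ) ≡ (r : ℤ) [ZMOD (k : ℤ)])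
    (hu : k * ∑ i ∈ Finset.Icc 1 k, a i ≤ u + 1 + t) :
    (prefixPaths k t (u + 1) a).ncard = (prefixPaths k t u a).ncard +
      if 0 < a r then (prefixPaths k t (u + 1) (Function.update a r (a r - 1))).ncard else 0 := by
  have hinj : ∀ s : Step, Function.Injective fun p : List Step => p ++ [s] :=
    fun s p q h => List.append_cancel_right h
  set D : Set (List Step) :=
    {p | 0 < a r ∧ p ∈ prefixPaths k t (u + 1) (Function.update a r (a r - 1))} with hD
  have hsplit : prefixPaths k t (u + 1) a =
      (fun p => p ++ [Step.up]) '' prefixPaths k t u a ∪ (fun p => p ++ [Step.down]) '' D := by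
    ext p
    constructor
    · intro hp
      rcases List.eq_nil_or_concat' p with rfl | ⟨q, s, rfl⟩
      · simpa using hp.1
      · cases s with
        | up => exact Or.inl ⟨q, (append_up_mem_prefixPaths hk hu).1 hp, rfl⟩
        | down => exact Or.inr ⟨q, (append_down_mem_prefixPaths hk hr hur hu).1 hp, rfl⟩
    · rintro (⟨q, hq, rfl⟩ | ⟨q, hq, rfl⟩)
      · exact (append_up_mem_prefixPaths hk hu).2 hq
      · exact (append_down_mem_prefixPaths hk hr hur hu).2 hq
  have hDfin : D.Finite := (prefixPaths_finite hk).subset fun p hp => hp.2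
  have hdisj : Disjoint ((fun p => p ++ [Step.up]) '' prefixPaths k t u a)
      ((fun p => p ++ [Step.down]) '' D) := by
    rw [Set.disjoint_left]
    rintro _ ⟨p, -, rfl⟩ ⟨q, -, h⟩
    simpa using (List.append_inj' h rfl).2
  rw [hsplit, Set.ncard_union_eq hdisj ((prefixPaths_finite hk).image _) (hDfin.image _),
    Set.ncard_image_of_injective _ (hinj _), Set.ncard_image_of_injective _ (hinj _)]
  congr 1
  split_ifs with h <;> simp [hD, h]

end PrefixPaths

/-! ### The closed formula and its recurrences. -/

/-- The number of paths with the residues `S` available, where the residues in `A` are available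
once more than the `m` times that the residues in `S \ A` are. -/
def ballotCount (S A : Finset ℕ) (m : ℕ) (a : ℕ → ℕ) : ℚ :=
  ((m : ℚ) * (m + 1) - (m + 1) * (∑ i ∈ S, a i : ℕ) + (∑ i ∈ A, a i : ℕ)) / (m * (m + 1)) *
    (∏ i ∈ A, (Nat.choose (m + a i) (a i) : ℚ)) *
    ∏ i ∈ S \ A, (Nat.choose (m + a i - 1) (a i) : ℚ)

theorem sum_update_pred {S : Finset ℕ} {r : ℕ} {a : ℕ → ℕ} (hr : r ∈ S) (h : 0 < a r) :
    ∑ i ∈ S, Function.update a r (a r - 1) i + 1 = ∑ i ∈ S, a i := by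
  rw [Finset.sum_update_of_mem hr, ← Finset.add_sum_erase S a hr, Finset.sdiff_singleton_eq_erase]
  omega

/-- The products agree, and both ballot factors reduce to `(m + 1 - ∑ a i) / (m + 1)`. -/
theorem ballotCount_full {S : Finset ℕ} {m : ℕ} (hm : 0 < m) (a : ℕ → ℕ) :
    ballotCount S S m a = ballotCount S ∅ (m + 1) a := by
  have hm' : (m : ℚ) ≠ 0 := by exact_mod_cast hm.ne'
  have hm1 : (m : ℚ) + 1 ≠ 0 := by positivity
  have hm2 : (m : ℚ) + 1 + 1 ≠ 0 := by positivity
  unfold ballotCount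
  have : ∀ i, m + 1 + a i - 1 = m + a i := fun i => by omega
  simp only [this, Finset.sdiff_self, Finset.prod_empty, Finset.sdiff_empty, Finset.sum_empty]
  push_cast
  field_simp
  ring

theorem ballotCount_insert {S A : Finset ℕ} {r m : ℕ} (hm : 0 < m) (hr : r ∈ S) (hrA : r ∉ A)
    (a : ℕ → ℕ) :
    ballotCount S (insert r A) m a = ballotCount S A m a +
      if 0 < a r then ballotCount S (insert r A) m (Function.update a r (a r - 1)) else 0 := by
  have hm' : (m : ℚ) ≠ 0 := by exact_mod_cast hm.ne'
  have hm1 : (m : ℚ) + 1 ≠ 0 := by positivity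
  have hSA : S \ A = insert r (S \ insert r A) := by
    ext i; simp only [Finset.mem_sdiff, Finset.mem_insert]
    rcases eq_or_ne i r with rfl | h <;> simp [*]
  have hnot : r ∉ S \ insert r A := by simp
  unfold ballotCount
  rw [hSA, Finset.prod_insert hnot, Finset.prod_insert hrA, Finset.sum_insert hrA]
  split_ifs with h
  · have hA : ∀ i ∈ A, Function.update a r (a r - 1) i = a i := fun i hi =>
      Function.update_of_ne (ne_of_mem_of_not_mem hi hrA) _ _
    have hB : ∀ i ∈ S \ insert r A, Function.update a r (a r - 1) i = a i := fun i hi =>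
      Function.update_of_ne (ne_of_mem_of_not_mem hi hnot) _ _
    have hPA : ∏ i ∈ A, (Nat.choose (m + Function.update a r (a r - 1) i)
        (Function.update a r (a r - 1) i) : ℚ) = ∏ i ∈ A, (Nat.choose (m + a i) (a i) : ℚ) :=
      Finset.prod_congr rfl fun i hi => by rw [hA i hi]
    have hPB : ∏ i ∈ S \ insert r A, (Nat.choose (m + Function.update a r (a r - 1) i - 1)
        (Function.update a r (a r - 1) i) : ℚ) =
        ∏ i ∈ S \ insert r A, (Nat.choose (m + a i - 1) (a i) : ℚ) :=
      Finset.prod_congr rfl fun i hi => by rw [hB i hi]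
    rw [Finset.prod_insert hrA, Finset.sum_insert hrA, Finset.sum_congr rfl hA, hPA, hPB,
      Function.update_self]
    have hs := sum_update_pred hr h
    rw [← hs]
    obtain ⟨x, hx⟩ : ∃ x, a r = x + 1 := ⟨a r - 1, by omega⟩
    rw [hx]
    have e1 : m + (x + 1) - 1 = m + x := by omega
    have e2 : x + 1 - 1 = x := rfl
    rw [e1, e2]
    have c1 : (Nat.choose (m + (x + 1)) (x + 1) : ℚ) =
        Nat.choose (m + x) x + Nat.choose (m + x) (x + 1) := by
      rw [← add_assoc, Nat.choose_succ_succ]; push_cast; rfl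
    -- Pascal's rule alone ignores the change of the ballot factor; this ratio of neighbouring
    -- binomials accounts for it.
    have c2 : (Nat.choose (m + x) (x + 1) : ℚ) * (x + 1) = Nat.choose (m + x) x * m := by
      have := Nat.choose_succ_right_eq (m + x) x
      rw [Nat.add_sub_cancel] at this
      exact_mod_cast this
    rw [c1]
    generalize (∏ i ∈ A, (Nat.choose (m + a i) (a i) : ℚ)) = P
    generalize (∏ i ∈ S \ insert r A, (Nat.choose (m + a i - 1) (a i) : ℚ)) = R
    generalize ∑ i ∈ S, Function.update a r (x + 1 - 1) i = s
    generalize ∑ i ∈ A, a i = w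
    push_cast
    field_simp
    linear_combination P * R * c2
  · have h0 : a r = 0 := by omega
    simp [h0]

/-! ### The cyclic order of the residues. -/

/-- The first `r` residues modulo `k`, represented in `1, …, k`, in the cyclic order that starts
at `k - t`. -/
def cyclicResidues (k t r : ℕ) : Finset ℕ :=
  (Finset.Icc 1 k).filter fun i => (k ≤ i + t ∧ i + t < k + r) ∨ i + t < r

theorem cyclicResidues_zero (k t : ℕ) : cyclicResidues k t 0 = ∅ := by
  ext i; simp only [cyclicResidues, Finset.mem_filter, Finset.mem_Icc, Finset.notMem_empty, iff_false]; omega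

theorem cyclicResidues_self {k t : ℕ} (ht : t < k) : cyclicResidues k t k = Finset.Icc 1 k := by
  ext i; simp only [cyclicResidues, Finset.mem_filter, Finset.mem_Icc]; omega

theorem exists_cyclicResidues_succ {k t r : ℕ} (ht : t < k) (hr : r < k) :
    ∃ s ∈ Finset.Icc 1 k, s ∉ cyclicResidues k t r ∧
      cyclicResidues k t (r + 1) = insert s (cyclicResidues k t r) ∧
      ((r : ℤ) - t) ≡ (s : ℤ) [ZMOD (k : ℤ)] := by
  rcases le_or_gt r t with h | h
  · refine ⟨k + r - t, by rw [Finset.mem_Icc]; omega, ?_, ?_, Int.modEq_iff_dvd.2 ⟨1, ?_⟩⟩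
    · simp only [cyclicResidues, Finset.mem_filter, Finset.mem_Icc]; omega
    · ext i
      simp only [cyclicResidues, Finset.mem_filter, Finset.mem_Icc, Finset.mem_insert]; omega
    · omega
  · refine ⟨r - t, by rw [Finset.mem_Icc]; omega, ?_, ?_, Int.modEq_iff_dvd.2 ⟨0, ?_⟩⟩
    · simp only [cyclicResidues, Finset.mem_filter, Finset.mem_Icc]; omega
    · ext i
      simp only [cyclicResidues, Finset.mem_filter, Finset.mem_Icc, Finset.mem_insert]; omega
    · omega

/-! ### Boundary values and the induction on `m` and `r`. -/

theorem ballotCount_empty_of_sum_eq {S : Finset ℕ} {m : ℕ} {a : ℕ → ℕ} (h : ∑ i ∈ S, a i = m) :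
    ballotCount S ∅ m a = 0 := by
  unfold ballotCount
  rw [h, Finset.sum_empty]
  push_cast
  ring

theorem ballotCount_of_sum_eq_zero {S : Finset ℕ} {m : ℕ} {a : ℕ → ℕ} (hm : 0 < m)
    (h : ∑ i ∈ S, a i = 0) : ballotCount S ∅ m a = 1 := by
  have hm' : (m : ℚ) ≠ 0 := by exact_mod_cast hm.ne'
  have hm1 : (m : ℚ) + 1 ≠ 0 := by positivity
  unfold ballotCount
  rw [h, Finset.prod_eq_one (s := S \ ∅) fun i hi => by
    rw [Finset.sum_eq_zero_iff.1 h i (Finset.sdiff_subset hi)]; simp]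
  simp [hm', hm1]

/-- If `ballotCount` counts the paths with `u` up-steps, then it counts those with `u + 1`, where
the residue of `u + 1` is available once more. -/
theorem ncard_prefixPaths_eq_ballotCount_insert {k t m u s : ℕ} {A : Finset ℕ} (hk : 0 < k)
    (hm : 0 < m) (hs : s ∈ Finset.Icc 1 k) (hsA : s ∉ A)
    (hus : ((u + 1 : ℕ) : ℤ) ≡ (s : ℤ) [ZMOD (k : ℤ)]) (hu : k * m ≤ u + 1 + t)
    (ih : ∀ a : ℕ → ℕ, ∑ i ∈ Finset.Icc 1 k, a i ≤ m →
      ((prefixPaths k t u a).ncard : ℚ) = ballotCount (Finset.Icc 1 k) A m a)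
    (a : ℕ → ℕ) (ha : ∑ i ∈ Finset.Icc 1 k, a i ≤ m) :
    ((prefixPaths k t (u + 1) a).ncard : ℚ) =
      ballotCount (Finset.Icc 1 k) (insert s A) m a := by
  -- The second term of the recurrence keeps `u + 1` and lowers `a s` by one.
  induction hx : a s generalizing a with
  | zero =>
    rw [ncard_prefixPaths_succ hk hs hus ((Nat.mul_le_mul_left k ha).trans hu),
      ballotCount_insert hm hs hsA, hx]
    simpa using ih a ha
  | succ x ihx =>
    have hpos : 0 < a s := by omega
    rw [ncard_prefixPaths_succ hk hs hus ((Nat.mul_le_mul_left k ha).trans hu),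
      ballotCount_insert hm hs hsA, if_pos hpos, if_pos hpos, Nat.cast_add, ih a ha,
      ihx (Function.update a s (a s - 1)) (by have := sum_update_pred hs hpos; omega)
        (by rw [Function.update_self]; omega)]

/-- For `1 ≤ r`, the bound `∑ a i ≤ m` says exactly that the endpoint is on or above the line. For
`r = 0` it also admits `∑ a i = m`, where both sides are zero. -/
theorem ncard_prefixPaths {k t : ℕ} (ht : t < k) {m : ℕ} (hm : 0 < m) {r : ℕ} (hr : r ≤ k)
    {u : ℕ} (hu : u + t + 1 = k * m + r) {a : ℕ → ℕ} (ha : ∑ i ∈ Finset.Icc 1 k, a i ≤ m) :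
    ((prefixPaths k t u a).ncard : ℚ) =
      ballotCount (Finset.Icc 1 k) (cyclicResidues k t r) m a := by
  have hk : 0 < k := by omega
  have step : ∀ {m r u : ℕ} {a : ℕ → ℕ}, 0 < m → r + 1 ≤ k → u + t + 1 = k * m + (r + 1) →
      ∑ i ∈ Finset.Icc 1 k, a i ≤ m →
      (∀ {v : ℕ}, v + t + 1 = k * m + r → ∀ b : ℕ → ℕ, ∑ i ∈ Finset.Icc 1 k, b i ≤ m →
        ((prefixPaths k t v b).ncard : ℚ) =
          ballotCount (Finset.Icc 1 k) (cyclicResidues k t r) m b) →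
      ((prefixPaths k t u a).ncard : ℚ) =
        ballotCount (Finset.Icc 1 k) (cyclicResidues k t (r + 1)) m a := by
    intro m r u a hm hr hu ha ih
    obtain ⟨s, hs, hsA, hins, hmod⟩ := exists_cyclicResidues_succ ht hr
    have hkm : k ≤ k * m := Nat.le_mul_of_pos_right k hm
    obtain ⟨v, rfl⟩ : ∃ v, u = v + 1 := ⟨u - 1, by omega⟩
    rw [hins]
    refine ncard_prefixPaths_eq_ballotCount_insert hk hm hs hsA ?_ (by omega)
      (ih (by omega)) a ha
    -- Here `v + 1 = k * m + (r - t)`.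
    refine Int.ModEq.trans (Int.modEq_iff_dvd.2 ⟨-m, ?_⟩) hmod
    have : ((v + 1 + t + 1 : ℕ) : ℤ) = (k * m + (r + 1) : ℕ) := by exact_mod_cast hu
    push_cast at this ⊢
    linarith
  induction m, hm using Nat.le_induction generalizing r u a with
  | base =>
    induction r generalizing u a with
    | zero =>
      rw [cyclicResidues_zero]
      have hlt := Nat.lt_of_succ_le (hu.trans (add_zero _)).le
      rcases Nat.le_one_iff_eq_zero_or_eq_one.1 ha with h | h
      · rw [prefixPaths_zero hk h, ballotCount_of_sum_eq_zero (Nat.succ_pos 0) h]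
        simp
      · rw [prefixPaths_eq_empty hk (by rw [h]; exact hlt), ballotCount_empty_of_sum_eq h]
        simp
    | succ r ihr => exact step one_pos hr hu ha fun hv b hb => ihr (by omega) hv hb
  | succ m hm ihm =>
    induction r generalizing u a with
    | zero =>
      rw [cyclicResidues_zero]
      have hlt := Nat.lt_of_succ_le (hu.trans (add_zero _)).le
      rcases Nat.le_succ_iff_eq_or_le.1 ha with h | h
      · rw [prefixPaths_eq_empty hk (by rw [h]; exact hlt), ballotCount_empty_of_sum_eq h]
        simp
      -- The same `u` is read with `m` and `r = k` in place of `m + 1` and `r = 0`.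
      · rw [ihm le_rfl (by rw [hu]; ring) h, cyclicResidues_self ht, ballotCount_full hm]
    | succ r ihr => exact step m.succ_pos hr hu ha fun hv b hb => ihr (by omega) hv hb

end KtDyck

theorem theorem2p3 (k t n : ℕ) (ht : t < k) (hn : 0 < n) (a : ℕ → ℕ)
    (ha : ∑ i ∈ Finset.Icc 1 k, a i = n) :
    ((KtDyck.paths k t n a).ncard : ℚ) =
      ((∑ i ∈ Finset.Icc (k - t) k, a i : ℕ) : ℚ) / ((n : ℚ) * ((n : ℚ) + 1)) *
        (∏ i ∈ Finset.Icc (k - t) k, (Nat.choose (n + a i) (a i) : ℚ)) *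
        (∏ i ∈ Finset.Icc 1 (k - t - 1), (Nat.choose (n + a i - 1) (a i) : ℚ)) := by
  have hA : KtDyck.cyclicResidues k t (t + 1) = Finset.Icc (k - t) k := by
    ext i; simp only [KtDyck.cyclicResidues, Finset.mem_filter, Finset.mem_Icc]; omega
  have hB : Finset.Icc 1 k \ Finset.Icc (k - t) k = Finset.Icc 1 (k - t - 1) := by
    ext i; simp only [Finset.mem_sdiff, Finset.mem_Icc]; omega
  rw [KtDyck.paths_eq_prefixPaths (by omega) ha,
    KtDyck.ncard_prefixPaths ht hn (r := t + 1) ht (add_assoc _ _ _) ha.le, hA,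
    KtDyck.ballotCount, hB, ha]
  -- Since `∑ a i = n = m`, the terms `m * (m + 1)` and `(m + 1) * ∑ a i` cancel, leaving the sum
  -- over `k - t, …, k`.
  congr 3
  ring
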